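/- **Theorem.** Let $H$ be a finite $r$-uniform hypergraph ($r\ge 1$) with vertex set $V(H)$ and edge set $E(H)$, and for $v \in V(H)$ let $E(v)$ be the set of edges containing $v$. A *local $k$-partition* of $H$ is a family $c=\{c_v\}_{v\in V(H)}$ of maps $c_v : E(v)\to\{1,\dots,k\}$. The hypergraph $H$ is *conflict $c$-colorable* if there is a map $\varphi: V(H)\to\{1,\dots,k\}$ such that no edge $e$ satisfies $\varphi(v)=c_v(e)$ for all $v\in e$. A *random local $k$-partition* of $H$ is obtained by choosing, for every edge $e$, the tuple $(c_v(e))_{v\in e}\in\{1,\dots,k\}^e$ uniformly at random, independently for distinct edges; $H$ is *single conflict $k$-colorable with probability $p$* if it is conflict $c$-colorable with probability $p$ for a random local $k$-partition $c$. Finally, $H$ is *$d$-degenerate* if every nonempty subhypergraph of $H$ (equivalently, every nonempty set $S$ of vertices with the edges of $H$ contained in $S$) has a vertex of degree at most $d$. For every $\varepsilon>0$ there are a positive integer $n_0$ and a real number $\delta=\delta(\varepsilon)>0$ such that the following holds for every integer $r$ with $1\le r<1.1/\varepsilon$. Let $d$ and $k$ be nonnegative integers and let $H$ be a $d$-degenerate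 $r$-uniform hypergraph with $n\ge n_0$ vertices such that $d\ge (\log n)^{1.1/\varepsilon}$. If $$k\ \ge\ (r+\delta)^{1/r}\left(\frac{d}{\log d}\right)^{1/r},$$ then $H$ is single conflict $k$-colorable with probability at least $1-\varepsilon$. -/

import Mathlib

open MeasureTheory ProbabilityTheory

namespace Hypergraph

variable {α : Type*}

/-- Every edge has exactly `r` vertices. -/
def IsUniform (H : Hypergraph α) (r : ℕ) : Prop :=
  ∀ e ∈ H.edgeSet, e.encard = r

/-- `d`-degeneracy: every nonempty induced subhypergraph (the vertices of `S` with the edges of `H`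
contained in `S`) has a vertex of degree at most `d`. -/
def IsDegenerate (H : Hypergraph α) (d : ℕ) : Prop :=
  ∀ S ⊆ H.vertexSet, S.Nonempty → ∃ v ∈ S, {e ∈ H.edgeSet | e ⊆ S ∧ v ∈ e}.encard ≤ d

/-- A local `k`-partition: a family of maps `c v : E(v) → Fin k`, one for every vertex `v`, where
`E(v)` is the set of the edges containing `v`. -/
abbrev LocalPartition (H : Hypergraph α) (k : ℕ) : Type _ :=
  (v : H.vertexSet) → {e : Set α // e ∈ H.edgeSet ∧ (v : α) ∈ e} → Fin k

/-- `H` is conflict `c`-colorable: some coloring `φ` of the vertices has no edge `e` such that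
`φ v = c v e` for every `v ∈ e`. -/
def ConflictColorable (H : Hypergraph α) {k : ℕ} (c : H.LocalPartition k) : Prop :=
  ∃ φ : H.vertexSet → Fin k, ∀ (e : Set α) (he : e ∈ H.edgeSet),
    ¬ ∀ (v : α) (hv : v ∈ e),
      φ ⟨v, H.mem_vertexSet_of_mem_edgeSet he hv⟩ =
        c ⟨v, H.mem_vertexSet_of_mem_edgeSet he hv⟩ ⟨e, he, hv⟩

/-- A choice, for every edge `e`, of a tuple of elements of `Fin k` indexed by the vertices
of `e`. -/
abbrev ConflictTuples (H : Hypergraph α) (k : ℕ) : Type _ :=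
  (e : H.edgeSet) → ↥e.1 → Fin k

/-- The local `k`-partition `c` with conflict tuple `(c v e)_{v ∈ e} = t e` at every edge `e`. -/
def ConflictTuples.toLocalPartition {H : Hypergraph α} {k : ℕ} (t : H.ConflictTuples k) :
    H.LocalPartition k :=
  fun v e => t ⟨e.1, e.2.1⟩ ⟨v, e.2.2⟩

instance finite_edgeSet (H : Hypergraph α) [Finite H.vertexSet] : Finite H.edgeSet :=
  Set.Finite.subset (Set.Finite.finite_subsets (Set.toFinite H.vertexSet))
    (fun _ he => H.subset_vertexSet_of_mem_edgeSet' he)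

/-- The law of the random local `k`-partition: the conflict tuples of the edges are independent,
and the tuple of each edge `e` is uniformly distributed on `e → Fin k`. -/
noncomputable def randomLocalPartition (H : Hypergraph α) [Finite H.vertexSet] (k : ℕ) :
    Measure (H.LocalPartition k) :=
  letI : Fintype H.edgeSet := Fintype.ofFinite _
  Measure.map ConflictTuples.toLocalPartition
    (Measure.pi fun e : H.edgeSet => uniformOn (Set.univ : Set (↥e.1 → Fin k)))

end Hypergraph

/-! Colour greedily along a degeneracy order. When `v` is coloured, at most `d` edges join it to
vertices already coloured, and their conflict tuples are independent of the choices made so far.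
Each such edge forbids any given colour of `v` with probability `p = k ^ (-r)`, and at most one
colour in all. Being forbidden is negatively correlated over the colours, so all `k` are forbidden
with probability at most `(1 - (1 - p) ^ d) ^ k` (`lmarginal_indicator_cover_le`), and a union bound
over the `n` vertices follows (`lmarginal_not_avoids_le`). Here `p * d ≤ log d / (r + δ)`, so for
large `δ` a colour is free with probability at least `d ^ (-γ)`, while `k ≥ d ^ (1 / r - γ)`. A step
thus fails with probability at most `exp (-d ^ (1 / r - 2γ))`. Since `log n ≤ d ^ (1 / A)` with `A =
1.1 / ε > 1 / (1 / r)`, this beats the factor `n` (`mul_cover_bound_le`). -/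

/-- The recursion step of the coupon collector bound. -/
theorem cover_bound_step {p a : ℝ} (hp : 0 ≤ p) (ha : 0 ≤ a) (ha1 : a ≤ 1) (j : ℕ) :
    (1 - j * p) * a ^ j + j * (p * a ^ (j - 1)) ≤ (a + p * (1 - a)) ^ j := by
  have h := mul_nonneg hp (sub_nonneg.2 ha1)
  induction j with
  | zero => simp
  | succ j ih =>
    have h2 : a ^ j ≤ (a + p * (1 - a)) ^ j := by gcongr; linarith
    rcases Nat.eq_zero_or_pos j with rfl | hj
    · simp; nlinarith
    · obtain ⟨m, rfl⟩ : ∃ m, j = m + 1 := ⟨j - 1, by omega⟩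
      simp only [Nat.add_sub_cancel] at ih ⊢
      push_cast at ih ⊢
      calc _ = a * ((1 - (m + 1) * p) * a ^ (m + 1) + (m + 1) * (p * a ^ m))
            + p * (1 - a) * a ^ (m + 1) := by ring
        _ ≤ a * (a + p * (1 - a)) ^ (m + 1) + p * (1 - a) * (a + p * (1 - a)) ^ (m + 1) := by
          gcongr
        _ = _ := by ring

/-! ### Coupon collector bound -/

section Cover

variable {ι κ : Type*} [Finite ι] [DecidableEq ι] {X : ι → Type*} [∀ i, MeasurableSpace (X i)]
  [∀ i, Finite (X i)] [∀ i, MeasurableSingletonClass (X i)]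

/-- A coupon collector bound: if each of `D.card` independent trials hits each `c` with
probability `p`, and at most one `c`, then the events that the single `c ∈ C` are hit are
negatively correlated. -/
theorem lmarginal_indicator_cover_le (μ : ∀ i, Measure (X i)) [∀ i, IsProbabilityMeasure (μ i)]
    (pt : ∀ i, κ → X i) {p : ℝ} (hp : 0 ≤ p) (hp1 : p ≤ 1) (D : Finset ι)
    (hinj : ∀ i ∈ D, Function.Injective (pt i))
    (hμ : ∀ i ∈ D, ∀ c, μ i {pt i c} = ENNReal.ofReal p) (C : Finset κ) (x : ∀ i, X i) :
    lmarginal μ D ({z : ∀ i, X i | ∀ c ∈ C, ∃ i ∈ D, z i = pt i c}.indicator 1) x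
      ≤ ENNReal.ofReal ((1 - (1 - p) ^ D.card) ^ C.card) := by
  classical
  induction D using Finset.induction generalizing C x with
  | empty =>
    rw [lmarginal_empty]
    rcases C.eq_empty_or_nonempty with rfl | ⟨c, hc⟩
    · simp
    · rw [Set.indicator_of_notMem]
      · simp
      · intro h
        obtain ⟨i, hi, -⟩ := h c hc
        simp at hi
  | insert i D hi ih =>
    replace ih := ih (fun i hi => hinj i (by simp [hi])) (fun i hi => hμ i (by simp [hi]))
    have hinji := hinj i (by simp)
    have hμi := hμ i (by simp)
    set F : Finset κ → (∀ i, X i) → ENNReal :=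
      fun C => {z : ∀ i, X i | ∀ c ∈ C, ∃ i ∈ D, z i = pt i c}.indicator 1 with hF
    set a : ℝ := 1 - (1 - p) ^ D.card with ha
    have hpw : (1 - p) ^ D.card ≤ 1 := pow_le_one₀ (by linarith) (by linarith)
    have hpw0 : 0 ≤ (1 - p) ^ D.card := pow_nonneg (by linarith) _
    have hhit : μ i (C.image (pt i) : Finset (X i)) = ENNReal.ofReal (C.card * p) := by
      rw [← sum_measure_singleton, Finset.sum_image fun _ _ _ _ h => hinji h,
        Finset.sum_congr rfl fun c _ => hμi c, Finset.sum_const, nsmul_eq_mul,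
        ENNReal.ofReal_mul (by positivity), ENNReal.ofReal_natCast]
    have hjp : C.card * p ≤ 1 := by
      have := hhit ▸ prob_le_one (μ := μ i) (s := (C.image (pt i) : Finset (X i)))
      exact ENNReal.ofReal_le_one.1 this
    have hmiss : μ i ((C.image (pt i) : Finset (X i)) : Set (X i))ᶜ
        = ENNReal.ofReal (1 - C.card * p) := by
      rw [prob_compl_eq_one_sub (Finset.measurableSet _), hhit,
        ENNReal.ofReal_sub _ (by positivity), ENNReal.ofReal_one]
    rw [lmarginal_insert' _ .of_discrete hi]
    -- Condition on trial `i`: if it hits nothing in `C`, then `D` must cover `C`; if it hits `c`,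
    -- then `D` must cover `C.erase c`.
    have key : (fun z : ∀ i, X i => ∫⁻ y, {z : ∀ i, X i | ∀ c ∈ C, ∃ i' ∈ insert i D,
          z i' = pt i' c}.indicator (1 : (∀ i, X i) → ENNReal) (Function.update z i y) ∂μ i)
        ≤ fun z => ENNReal.ofReal (1 - C.card * p) * F C z
          + ∑ c ∈ C, ENNReal.ofReal p * F (C.erase c) z := by
      intro z
      calc _ ≤ ∫⁻ y, ((((C.image (pt i) : Finset (X i)) : Set (X i))ᶜ).indicator 1 y * F C z
            + ∑ c ∈ C, ({pt i c} : Set (X i)).indicator 1 y * F (C.erase c) z) ∂μ i := by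
            refine lintegral_mono fun y => ?_
            rw [Set.indicator_apply]
            split_ifs with hz
            · have hne : ∀ j ∈ D, Function.update z i y j = z j := fun j hj =>
                Function.update_of_ne (by rintro rfl; exact hi hj) _ _
              simp only [Set.mem_ofPred_eq, Finset.mem_insert, exists_eq_or_imp,
                Function.update_self] at hz
              by_cases hy : y ∈ C.image (pt i)
              · obtain ⟨c, hc, rfl⟩ := Finset.mem_image.1 hy
                refine le_trans ?_ le_add_self
                refine le_trans ?_ (Finset.single_le_sum (fun _ _ => zero_le) hc)
                rw [Set.indicator_of_mem (by simp), hF]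
                simp only
                rw [Set.indicator_of_mem]
                · simp
                · intro c' hc'
                  rcases hz c' (Finset.mem_of_mem_erase hc') with h | ⟨j, hj, h⟩
                  · exact absurd (hinji h).symm (Finset.ne_of_mem_erase hc')
                  · exact ⟨j, hj, by rw [← hne j hj, h]⟩
              · refine le_trans ?_ le_self_add
                rw [Set.indicator_of_mem (by simpa using hy), hF]
                simp only
                rw [Set.indicator_of_mem]
                · simp
                · intro c' hc'
                  rcases hz c' hc' with h | ⟨j, hj, h⟩
                  · exact absurd (Finset.mem_image.2 ⟨c', hc', h.symm⟩) hy
                  · exact ⟨j, hj, by rw [← hne j hj, h]⟩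
            · exact zero_le
        _ = _ := by
            rw [lintegral_add_left .of_discrete, lintegral_finsetSum _ fun _ _ => .of_discrete,
              lintegral_mul_const _ .of_discrete, lintegral_indicator_one .of_discrete, hmiss]
            congr 1
            refine Finset.sum_congr rfl fun c _ => ?_
            rw [lintegral_mul_const _ .of_discrete, lintegral_indicator_one .of_discrete, hμi]
    refine (lmarginal_mono key x).trans ?_
    have hexp : lmarginal μ D (fun z => ENNReal.ofReal (1 - C.card * p) * F C z
          + ∑ c ∈ C, ENNReal.ofReal p * F (C.erase c) z) x
        = ENNReal.ofReal (1 - C.card * p) * lmarginal μ D (F C) x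
          + ∑ c ∈ C, ENNReal.ofReal p * lmarginal μ D (F (C.erase c)) x := by
      simp only [lmarginal]
      rw [lintegral_add_left .of_discrete, lintegral_finsetSum _ fun _ _ => .of_discrete,
        lintegral_const_mul _ .of_discrete]
      congr 1
      exact Finset.sum_congr rfl fun c _ => lintegral_const_mul _ .of_discrete
    rw [hexp]
    have ha0 : 0 ≤ a := by linarith
    calc _ ≤ ENNReal.ofReal (1 - C.card * p) * ENNReal.ofReal (a ^ C.card)
          + ∑ c ∈ C, ENNReal.ofReal p * ENNReal.ofReal (a ^ (C.card - 1)) := by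
          gcongr with c hc
          · exact ih C x
          · rw [← Finset.card_erase_of_mem hc]
            exact ih _ x
      _ = ENNReal.ofReal ((1 - C.card * p) * a ^ C.card
          + C.card * (p * a ^ (C.card - 1))) := by
          rw [Finset.sum_const, nsmul_eq_mul, ← ENNReal.ofReal_mul (by linarith),
            ← ENNReal.ofReal_mul hp, ← ENNReal.ofReal_natCast,
            ← ENNReal.ofReal_mul (by positivity), ← ENNReal.ofReal_add]
          · exact mul_nonneg (by linarith) (by positivity)
          · positivity
      _ ≤ _ := by
          refine ENNReal.ofReal_le_ofReal ((cover_bound_step hp ha0 (by linarith) _).trans_eq ?_)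
          rw [Finset.card_insert_of_notMem hi, ha]
          ring

end Cover

/-! ### Greedy colouring along a degeneracy order -/

namespace Hypergraph

variable {α : Type*}

/-- `φ` avoids the conflict tuples `t` of all edges contained in `S`. -/
def ConflictTuples.Avoids {H : Hypergraph α} {k : ℕ} (t : H.ConflictTuples k) (S : Set α)
    (φ : α → Fin k) : Prop :=
  ∀ e : H.edgeSet, e.1 ⊆ S → t e ≠ fun v : ↥e.1 => φ v

theorem ConflictTuples.conflictColorable_of_avoids {H : Hypergraph α} {k : ℕ}
    {t : H.ConflictTuples k} {φ : α → Fin k} (h : t.Avoids H.vertexSet φ) :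
    H.ConflictColorable t.toLocalPartition := by
  refine ⟨fun v => φ v, fun e he hφ => h ⟨e, he⟩ (H.subset_vertexSet_of_mem_edgeSet' he) ?_⟩
  exact funext fun v => (hφ v v.2).symm

theorem finite_edge (H : Hypergraph α) [Finite H.vertexSet] (e : H.edgeSet) : Finite ↥e.1 :=
  Set.Finite.subset (Set.toFinite H.vertexSet) (H.subset_vertexSet_of_mem_edgeSet' e.2)

theorem uniformOn_univ_singleton {β : Type*} [Finite β] {r k : ℕ} (hβ : Nat.card β = r)
    (a : β → Fin k) :
    uniformOn (Set.univ : Set (β → Fin k)) {a} = ENNReal.ofReal ((k : ℝ) ^ r)⁻¹ := by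
  classical
  have := Fintype.ofFinite β
  have hk : 0 < (k : ℝ) ^ r := by
    rcases Nat.eq_zero_or_pos k with rfl | hk
    · have : IsEmpty β := ⟨fun b => (a b).elim0⟩
      simp [← hβ]
    · positivity
  rw [uniformOn_univ, Measure.count_singleton, Fintype.card_fun, Fintype.card_fin,
    ← Nat.card_eq_fintype_card, hβ, ENNReal.ofReal_inv_of_pos hk, one_div,
    ENNReal.ofReal_pow (by positivity), ENNReal.ofReal_natCast, Nat.cast_pow]

open Classical in
/-- Colour greedily along a degeneracy order: each vertex in turn fails with probability at most
`(1 - (1 - k ^ (-r)) ^ d) ^ k`. -/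
theorem lmarginal_not_avoids_le (H : Hypergraph α) [Finite H.vertexSet] {r d k : ℕ} (hr : 1 ≤ r)
    (hk : 0 < k) (hunif : H.IsUniform r) (hdeg : H.IsDegenerate d) {S : Set α}
    (hS : S ⊆ H.vertexSet) (x : H.ConflictTuples k) :
    lmarginal (fun e : H.edgeSet => uniformOn (Set.univ : Set (↥e.1 → Fin k)))
      (Set.toFinite {e : H.edgeSet | e.1 ⊆ S}).toFinset
      ({t : H.ConflictTuples k | ¬ ∃ φ, t.Avoids S φ}.indicator 1) x
      ≤ ENNReal.ofReal (S.ncard * (1 - (1 - ((k : ℝ) ^ r)⁻¹) ^ d) ^ k) := by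
  have : ∀ e : H.edgeSet, Finite ↥e.1 := H.finite_edge
  have : Nonempty (Fin k) := ⟨⟨0, hk⟩⟩
  set μ := fun e : H.edgeSet => uniformOn (Set.univ : Set (↥e.1 → Fin k)) with hμ
  have hprob : ∀ e, IsProbabilityMeasure (μ e) := fun e => by rw [hμ]; infer_instance
  set p : ℝ := ((k : ℝ) ^ r)⁻¹ with hp
  have hk1 : (1 : ℝ) ≤ k := by exact_mod_cast hk
  have hp0 : 0 ≤ p := by positivity
  have hp1 : p ≤ 1 := inv_le_one_of_one_le₀ (one_le_pow₀ hk1)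
  have hb0 : 0 ≤ 1 - (1 - p) ^ d := sub_nonneg.2 (pow_le_one₀ (by linarith) (by linarith))
  induction hn : S.ncard generalizing S x with
  | zero =>
    have hS0 : S = ∅ := (Set.ncard_eq_zero ((Set.toFinite H.vertexSet).subset hS)).1 hn
    have : {t : H.ConflictTuples k | ¬ ∃ φ, t.Avoids S φ} = ∅ := by
      refine Set.eq_empty_of_forall_notMem fun t ht => ht ⟨fun _ => ⟨0, hk⟩, fun e he => ?_⟩
      have h1 := hunif e.1 e.2
      rw [hS0, Set.subset_empty_iff] at he
      rw [he, Set.encard_empty] at h1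
      have : r = 0 := by exact_mod_cast h1.symm
      omega
    rw [this]
    simp [lmarginal]
  | succ n ih =>
    have hSf : S.Finite := (Set.toFinite H.vertexSet).subset hS
    obtain ⟨v, hv, hvd⟩ := hdeg S hS ((Set.ncard_pos hSf).1 (by omega))
    set S' := S \ {v} with hS'
    set E : Finset H.edgeSet := (Set.toFinite {e : H.edgeSet | e.1 ⊆ S'}).toFinset with hE
    set D : Finset H.edgeSet := (Set.toFinite {e : H.edgeSet | e.1 ⊆ S ∧ v ∈ e.1}).toFinset with hD
    have hED : (Set.toFinite {e : H.edgeSet | e.1 ⊆ S}).toFinset = E ∪ D := by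
      ext e
      simp only [hE, hD, hS', Set.Finite.mem_toFinset, Set.mem_ofPred_eq, Finset.mem_union,
        Set.subset_sdiff, Set.disjoint_singleton_right]
      tauto
    have hdisj : Disjoint E D := by
      refine Finset.disjoint_left.2 fun e he he' => ?_
      simp only [hE, hD, hS', Set.Finite.mem_toFinset, Set.mem_ofPred_eq,
        Set.subset_sdiff, Set.disjoint_singleton_right] at he he'
      exact he.2 he'.2
    have hDd : D.card ≤ d := by
      have h1 : {e ∈ H.edgeSet | e ⊆ S ∧ v ∈ e}
          = Subtype.val '' (D : Set H.edgeSet) := by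
        ext e
        simp only [hD, Set.Finite.coe_toFinset, Set.mem_ofPred_eq, Set.mem_image, Subtype.exists,
          exists_and_right, exists_eq_right]
        exact ⟨fun h => ⟨⟨h.1, h.2.1⟩, h.2.2⟩, fun ⟨⟨h, h'⟩, h''⟩ => ⟨h, h', h''⟩⟩
      rw [h1, Subtype.val_injective.encard_image, Set.encard_coe_eq_coe_finsetCard] at hvd
      exact_mod_cast hvd
    set q : ℝ := (1 - (1 - p) ^ d) ^ k with hq
    -- Avoidance on `S'` involves only tuples in `E`, so a good `φ` on `S'` stays fixed while those
    -- in `D` are resampled.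
    have key : lmarginal μ D ({t : H.ConflictTuples k | ¬ ∃ φ, t.Avoids S φ}.indicator 1)
        ≤ fun t : H.ConflictTuples k => {t : H.ConflictTuples k | ¬ ∃ φ, t.Avoids S' φ}.indicator 1 t
          + ENNReal.ofReal q := by
      intro (t : H.ConflictTuples k)
      by_cases ht : ∃ φ, t.Avoids S' φ
      · obtain ⟨φ, hφ⟩ := ht
        refine le_trans ?_ le_add_self
        -- The trials are the edges of `D`; one hits `c` when its tuple is `φ` with `v` recoloured
        -- `c`. A colour that is never hit extends `φ` to `v`.
        have hcov := lmarginal_indicator_cover_le μ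
          (fun e (c : Fin k) (u : ↥e.1) => Function.update φ v c u) hp0 hp1 D ?_ ?_
          Finset.univ t
        · refine le_trans ?_ (hcov.trans (ENNReal.ofReal_le_ofReal ?_))
          · refine lintegral_mono fun y => ?_
            set w : H.ConflictTuples k := Function.updateFinset t D y with hw
            rw [Set.indicator_apply]
            split_ifs with hbad
            · rw [Set.indicator_of_mem]
              intro c _
              by_contra! hc
              refine hbad ⟨Function.update φ v c, fun e he => ?_⟩
              by_cases hve : v ∈ e.1
              · exact hc e (by simpa [hD] using ⟨he, hve⟩)
              · have heD : e ∉ D := by simp [hD, hve]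
                have hwe : w e = t e := by simp [hw, Function.updateFinset, heD]
                rw [hwe]
                have hagree : (fun u : ↥e.1 => Function.update φ v c u) = fun u : ↥e.1 => φ u :=
                  funext fun u => Function.update_of_ne (by rintro rfl; exact hve u.2) _ _
                rw [hagree]
                exact hφ e (Set.subset_sdiff.2 ⟨he, Set.disjoint_singleton_right.2 hve⟩)
            · exact zero_le
          · rw [Finset.card_univ, Fintype.card_fin, hq]
            have h1 : (1 - p) ^ d ≤ (1 - p) ^ D.card :=
              pow_le_pow_of_le_one (by linarith) (by linarith) hDd
            have h2 : (1 - p) ^ D.card ≤ 1 := pow_le_one₀ (by linarith) (by linarith)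
            gcongr
        · intro e he c c' h
          have he' : v ∈ e.1 := by
            simp only [hD, Set.Finite.mem_toFinset, Set.mem_ofPred_eq] at he
            exact he.2
          simpa using congrFun h ⟨v, he'⟩
        · intro e _ c
          refine uniformOn_univ_singleton ?_ _
          have := hunif e.1 e.2
          rw [Nat.card_coe_set_eq, Set.ncard, this, ENat.toNat_natCast]
      · refine le_trans ?_ le_self_add
        rw [Set.indicator_of_mem (by exact ht)]
        calc _ ≤ lmarginal μ D (fun _ => 1) t :=
              lmarginal_mono (fun y => Set.indicator_le_self' (by simp) y) t
          _ = _ := by simp [lmarginal]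
    rw [hED, lmarginal_union _ _ .of_discrete hdisj]
    refine (lmarginal_mono key x).trans ?_
    have hsplit : lmarginal μ E (fun t : H.ConflictTuples k =>
        {t : H.ConflictTuples k | ¬ ∃ φ, t.Avoids S' φ}.indicator 1 t + ENNReal.ofReal q) x
        = lmarginal μ E ({t : H.ConflictTuples k | ¬ ∃ φ, t.Avoids S' φ}.indicator 1) x
          + ENNReal.ofReal q := by
      simp only [lmarginal]
      rw [lintegral_add_left .of_discrete]
      simp
    have hn' : S'.ncard = n := by
      rw [hS', Set.ncard_sdiff_singleton_of_mem hv, hn, Nat.add_sub_cancel]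
    rw [hsplit]
    refine (add_le_add_left (ih (Set.sdiff_subset.trans hS) x hn') _).trans ?_
    rw [← ENNReal.ofReal_add (by positivity) (by positivity)]
    refine ENNReal.ofReal_le_ofReal (le_of_eq ?_)
    push_cast
    ring

end Hypergraph

/-! ### Asymptotic estimates -/

open Filter Topology in
-- Only finitely many `r` lie below `A`, so one gap serves them all. Of the three `γ`, one absorbs
-- `log d` in the bound on `k`, one the probability `d ^ (-γ)` of a free colour, and one is left to
-- absorb `ε`.
theorem exists_pos_add_le_inv_nat (A : ℝ) :
    ∃ γ : ℝ, 0 < γ ∧ ∀ r : ℕ, 1 ≤ r → (r : ℝ) < A → 1 / A + 3 * γ ≤ 1 / r := by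
  have hfin : {r : ℕ | 1 ≤ r ∧ (r : ℝ) < A}.Finite :=
    (Set.finite_Iio ⌈A⌉₊).subset fun r hr => Nat.lt_ceil.2 hr.2
  have h : ∀ᶠ γ : ℝ in 𝓝[>] 0, ∀ r ∈ {r : ℕ | 1 ≤ r ∧ (r : ℝ) < A}, 1 / A + 3 * γ ≤ 1 / r := by
    refine (eventually_all_finite hfin).2 fun r hr => ?_
    have hr0 : (0 : ℝ) < r := by exact_mod_cast hr.1
    have hlim : Tendsto (fun γ : ℝ => 1 / A + 3 * γ) (𝓝[>] 0) (𝓝 (1 / A + 3 * 0)) :=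
      Tendsto.mono_left (Continuous.tendsto (by fun_prop) _) nhdsWithin_le_nhds
    refine (hlim.eventually (gt_mem_nhds ?_)).mono fun _ h => le_of_lt h
    rw [mul_zero, add_zero]
    exact one_div_lt_one_div_of_lt hr0 hr.2
  obtain ⟨γ, hγ, hγ0⟩ := (h.and self_mem_nhdsWithin).exists
  exact ⟨γ, hγ0, fun r h1 h2 => hγ r ⟨h1, h2⟩⟩

theorem exp_neg_two_mul_le {p : ℝ} (hp : 0 ≤ p) (hp2 : p ≤ 1 / 2) :
    Real.exp (-(2 * p)) ≤ 1 - p := by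
  rw [Real.exp_neg]
  refine inv_le_of_inv_le₀ (by linarith) ?_
  refine le_trans ?_ (Real.add_one_le_exp (2 * p))
  rw [inv_le_iff_one_le_mul₀ (by linarith)]
  nlinarith

/-- The union bound over the `n` greedy steps, once `x = d` is large. -/
theorem mul_cover_bound_le {A γ δ ε : ℝ} (hA : 0 < A) (hγ : 0 < γ) (hδ : 1 ≤ δ) (hδγ : 2 / γ ≤ δ)
    (hε : 0 < ε) {r n d k : ℕ} (hr : 1 ≤ r) (hrA : 1 / A + 3 * γ ≤ 1 / r) (hn : 1 ≤ n)
    (hd : (1 : ℝ) ≤ d) (hL : 1 ≤ Real.log d) (hLγ : Real.log d ≤ (d : ℝ) ^ γ)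
    (hεγ : 1 + |Real.log ε| ≤ (d : ℝ) ^ γ) (hnd : Real.log n ^ A ≤ d)
    (hk : ((r : ℝ) + δ) ^ (1 / (r : ℝ)) * ((d : ℝ) / Real.log (d : ℝ)) ^ (1 / (r : ℝ)) ≤ k) :
    0 < k ∧ (n : ℝ) * (1 - (1 - ((k : ℝ) ^ r)⁻¹) ^ d) ^ k ≤ ε := by
  have hr1 : (1 : ℝ) ≤ r := by exact_mod_cast hr
  set x : ℝ := (d : ℝ)
  set L := Real.log x with hLdef
  have hx0 : 0 < x := by linarith
  have hL0 : 0 < L := by linarith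
  have hrinv : 1 / (r : ℝ) ≤ 1 := by rw [div_le_one (by linarith)]; exact hr1
  have hkx : x ^ (1 / (r : ℝ) - γ) ≤ k := by
    refine le_trans ?_ hk
    have h1 : 1 ≤ ((r : ℝ) + δ) ^ (1 / (r : ℝ)) := Real.one_le_rpow (by linarith) (by positivity)
    have h2 : L ^ (1 / (r : ℝ)) ≤ x ^ γ :=
      (Real.rpow_le_rpow_of_exponent_le hL hrinv).trans (by rwa [Real.rpow_one])
    calc _ = x ^ (1 / (r : ℝ)) / x ^ γ := Real.rpow_sub hx0 _ _
      _ ≤ x ^ (1 / (r : ℝ)) / L ^ (1 / (r : ℝ)) := by gcongr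
      _ = (x / L) ^ (1 / (r : ℝ)) := (Real.div_rpow hx0.le hL0.le _).symm
      _ ≤ _ := le_mul_of_one_le_left (by positivity) h1
  have hk0 : (0 : ℝ) < k := lt_of_lt_of_le (by positivity) hkx
  refine ⟨by exact_mod_cast hk0, ?_⟩
  have hkr : (r + δ) * (x / L) ≤ (k : ℝ) ^ r := by
    rw [← Real.mul_rpow (by positivity) (by positivity)] at hk
    have := pow_le_pow_left₀ (by positivity) hk r
    rwa [one_div, Real.rpow_inv_natCast_pow (by positivity) (by omega)] at this
  set p : ℝ := ((k : ℝ) ^ r)⁻¹ with hp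
  have hp0 : 0 ≤ p := by positivity
  have hLx : L ≤ x := (Real.log_le_sub_one_of_pos hx0).trans (by linarith)
  have hpd : p * x ≤ L / (r + δ) := by
    rw [hp, inv_mul_le_iff₀ (by positivity), mul_div_assoc', le_div_iff₀ (by positivity)]
    rw [mul_div_assoc', div_le_iff₀ hL0] at hkr
    linarith
  have hp2 : p ≤ 1 / 2 := by
    rw [hp, one_div]
    refine inv_anti₀ (by norm_num) (le_trans ?_ hkr)
    have : 1 ≤ x / L := by rwa [one_le_div hL0]
    nlinarith
  -- `1 - p ≥ exp (-2p)` gives the exponent `2 / (r + δ)`, at most `γ` because `δ ≥ 2 / γ`.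
  have hmiss : x ^ (-γ) ≤ (1 - p) ^ d := by
    calc x ^ (-γ) = Real.exp (-(L * γ)) := by rw [Real.rpow_def_of_pos hx0, mul_neg]
      _ ≤ Real.exp (d * -(2 * p)) := by
          refine Real.exp_le_exp.2 ?_
          have h1 : L / (r + δ) * 2 ≤ L * γ := by
            rw [div_mul_eq_mul_div, div_le_iff₀ (by linarith), mul_assoc]
            rw [div_le_iff₀ hγ] at hδγ
            gcongr
            nlinarith
          have : (d : ℝ) = x := rfl
          rw [this]
          linarith
      _ = Real.exp (-(2 * p)) ^ d := Real.exp_nat_mul _ _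
      _ ≤ _ := by
          gcongr
          exact exp_neg_two_mul_le hp0 hp2
  have hpow : (1 - (1 - p) ^ d) ^ k ≤ Real.exp (-x ^ (1 / A + γ)) := by
    have h0 : (1 - p) ^ d ≤ 1 := pow_le_one₀ (by linarith) (by linarith)
    calc _ ≤ Real.exp (-x ^ (-γ)) ^ k := by
          refine pow_le_pow_left₀ (by linarith) ?_ k
          have := Real.add_one_le_exp (-x ^ (-γ))
          linarith
      _ = Real.exp (k * -x ^ (-γ)) := (Real.exp_nat_mul _ _).symm
      _ ≤ _ := by
          rw [mul_neg]
          refine Real.exp_le_exp.2 (neg_le_neg ?_)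
          calc x ^ (1 / A + γ) ≤ x ^ (1 / (r : ℝ) - γ + -γ) :=
                Real.rpow_le_rpow_of_exponent_le hd (by linarith)
            _ = x ^ (1 / (r : ℝ) - γ) * x ^ (-γ) := Real.rpow_add hx0 _ _
            _ ≤ _ := by gcongr
  have hn1 : (1 : ℝ) ≤ n := by exact_mod_cast hn
  have hlogn : Real.log n ≤ x ^ (1 / A) := by
    rw [one_div]
    exact (Real.le_rpow_inv_iff_of_pos (Real.log_nonneg hn1) hx0.le hA).2 hnd
  have hexp : x ^ (1 / A) + |Real.log ε| ≤ x ^ (1 / A + γ) := by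
    rw [Real.rpow_add hx0]
    have : 1 ≤ x ^ (1 / A) := Real.one_le_rpow hd (by positivity)
    nlinarith [abs_nonneg (Real.log ε)]
  calc _ ≤ Real.exp (Real.log n) * Real.exp (-x ^ (1 / A + γ)) := by
        rw [Real.exp_log (by linarith)]
        gcongr
    _ = Real.exp (Real.log n + -x ^ (1 / A + γ)) := (Real.exp_add _ _).symm
    _ ≤ Real.exp (Real.log ε) := by
        refine Real.exp_le_exp.2 ?_
        have := neg_abs_le (Real.log ε)
        linarith
    _ = ε := Real.exp_log hε

open Filter in
theorem exists_threshold {A ε : ℝ} (hA : 0 < A) (hε : 0 < ε) :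
    ∃ n₀ : ℕ, 0 < n₀ ∧ ∃ δ : ℝ, 0 < δ ∧ ∀ r : ℕ, 1 ≤ r → (r : ℝ) < A → ∀ n d k : ℕ, n₀ ≤ n →
      Real.log n ^ A ≤ d →
      ((r : ℝ) + δ) ^ (1 / (r : ℝ)) * ((d : ℝ) / Real.log (d : ℝ)) ^ (1 / (r : ℝ)) ≤ k →
      0 < k ∧ (n : ℝ) * (1 - (1 - ((k : ℝ) ^ r)⁻¹) ^ d) ^ k ≤ ε := by
  obtain ⟨γ, hγ, hγr⟩ := exists_pos_add_le_inv_nat A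
  have h1 : ∀ᶠ x : ℝ in atTop, Real.log x ≤ x ^ γ :=
    ((isLittleO_log_rpow_atTop hγ).bound one_pos).and (eventually_ge_atTop 0) |>.mono
      fun x ⟨h, hx⟩ => by
        rw [one_mul, Real.norm_of_nonneg (Real.rpow_nonneg hx γ)] at h
        exact (le_abs_self _).trans h
  obtain ⟨X, hX⟩ := eventually_atTop.1 ((eventually_ge_atTop (1 : ℝ)).and
    ((Real.tendsto_log_atTop.eventually_ge_atTop 1).and
    (h1.and ((tendsto_rpow_atTop hγ).eventually_ge_atTop (1 + |Real.log ε|)))))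
  obtain ⟨N, hN⟩ := eventually_atTop.1 (((tendsto_rpow_atTop hA).comp
    (Real.tendsto_log_atTop.comp tendsto_natCast_atTop_atTop)).eventually_ge_atTop X)
  -- `N + 1` makes `n` positive; `2 / γ + 1` exceeds both `2 / γ` and `1`.
  refine ⟨N + 1, N.succ_pos, 2 / γ + 1, by positivity, fun r hr hrA n d k hn hnd hk => ?_⟩
  obtain ⟨hd, hL, hLγ, hεγ⟩ := hX d ((hN n (by omega)).trans hnd)
  exact mul_cover_bound_le hA hγ (by have : 0 < 2 / γ := by positivity
                                     linarith) (by linarith) hε hr (hγr r hr hrA) (by omega)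
    hd hL hLγ hεγ hnd hk

/-! ### Transfer to the random local partition -/

namespace Hypergraph

theorem one_sub_le_randomLocalPartition_real {α : Type*} (H : Hypergraph α) [Finite H.vertexSet]
    {r d k : ℕ} (hr : 1 ≤ r) (hk : 0 < k) (hunif : H.IsUniform r) (hdeg : H.IsDegenerate d) :
    1 - H.vertexSet.ncard * (1 - (1 - ((k : ℝ) ^ r)⁻¹) ^ d) ^ k
      ≤ (H.randomLocalPartition k).real {c | H.ConflictColorable c} := by
  classical
  have : ∀ e : H.edgeSet, Finite ↥e.1 := H.finite_edge
  have : Nonempty (Fin k) := ⟨⟨0, hk⟩⟩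
  let : Fintype H.edgeSet := Fintype.ofFinite _
  have hfin : ∀ v : H.vertexSet, Finite {e : Set α // e ∈ H.edgeSet ∧ (v : α) ∈ e} := fun v =>
    (Set.toFinite H.edgeSet).subset fun e he => he.1
  set P : Measure (H.ConflictTuples k) :=
    Measure.pi fun e : H.edgeSet => uniformOn (Set.univ : Set (↥e.1 → Fin k)) with hP
  have hmeas : Measurable (ConflictTuples.toLocalPartition : H.ConflictTuples k → _) :=
    .of_discrete
  have hset : MeasurableSet {c : H.LocalPartition k | H.ConflictColorable c} := .of_discrete
  have hmap : (H.randomLocalPartition k).real {c | H.ConflictColorable c}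
      = P.real {t | H.ConflictColorable t.toLocalPartition} := by
    rw [measureReal_def, randomLocalPartition, Measure.map_apply hmeas hset]
    rfl
  set B : Set (H.ConflictTuples k) := {t | ¬ ∃ φ, t.Avoids H.vertexSet φ} with hB
  have hq : 0 ≤ (1 - (1 - ((k : ℝ) ^ r)⁻¹) ^ d) ^ k := by
    have hk1 : (1 : ℝ) ≤ k := by exact_mod_cast hk
    have h1 : ((k : ℝ) ^ r)⁻¹ ≤ 1 := inv_le_one_of_one_le₀ (one_le_pow₀ hk1)
    have h2 : 0 ≤ ((k : ℝ) ^ r)⁻¹ := by positivity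
    exact pow_nonneg (sub_nonneg.2 (pow_le_one₀ (by linarith) (by linarith))) _
  have hbad : P.real B ≤ H.vertexSet.ncard * (1 - (1 - ((k : ℝ) ^ r)⁻¹) ^ d) ^ k := by
    refine ENNReal.toReal_le_of_le_ofReal (by positivity) ?_
    -- With `S` the whole vertex set every coordinate is integrated, so the base point is arbitrary.
    have h := H.lmarginal_not_avoids_le hr hk hunif hdeg subset_rfl (fun _ _ => ⟨0, hk⟩)
    have huniv : (Set.toFinite {e : H.edgeSet | e.1 ⊆ H.vertexSet}).toFinset = Finset.univ := by
      ext e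
      simp
    rw [huniv, ← lintegral_eq_lmarginal_univ, lintegral_indicator_one .of_discrete] at h
    exact h
  have hgood : Bᶜ ⊆ {t | H.ConflictColorable t.toLocalPartition} := fun t ht => by
    obtain ⟨φ, hφ⟩ := not_not.1 ht
    exact ConflictTuples.conflictColorable_of_avoids hφ
  have hcompl : P.real Bᶜ = 1 - P.real B := probReal_compl_eq_one_sub .of_discrete
  rw [hmap]
  have := measureReal_mono hgood (μ := P)
  linarith

end Hypergraph

theorem mainTheorem4 :
    ∀ ε : ℝ, 0 < ε → ∃ n₀ : ℕ, 0 < n₀ ∧ ∃ δ : ℝ, 0 < δ ∧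
      ∀ (r : ℕ), 1 ≤ r → (r : ℝ) < 1.1 / ε →
      ∀ {α : Type*} (H : Hypergraph α) [Finite H.vertexSet] (d k : ℕ),
        H.IsUniform r → H.IsDegenerate d →
        n₀ ≤ H.vertexSet.ncard →
        Real.log (H.vertexSet.ncard : ℝ) ^ (1.1 / ε) ≤ (d : ℝ) →
        ((r : ℝ) + δ) ^ (1 / (r : ℝ)) * ((d : ℝ) / Real.log (d : ℝ)) ^ (1 / (r : ℝ)) ≤ (k : ℝ) →
        1 - ε ≤ (H.randomLocalPartition k).real {c | H.ConflictColorable c} := by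
  intro ε hε
  obtain ⟨n₀, hn₀, δ, hδ, h⟩ := exists_threshold (A := 1.1 / ε) (by positivity) hε
  refine ⟨n₀, hn₀, δ, hδ, fun r hr hrA α H _ d k hunif hdeg hn hnd hk => ?_⟩
  obtain ⟨hk0, hle⟩ := h r hr hrA _ d k hn hnd hk
  linarith [H.one_sub_le_randomLocalPartition_real hr hk0 hunif hdeg]
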